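/- Let $y = X\beta^* + \xi$, where $X \in \mathbb{R}^{n\times p}$ ($n \ge 1$) is fixed with every column of Euclidean norm $n^{1/2}$, and $\xi_1,\dots,\xi_n$ are i.i.d., centred and sub-Gaussian with scale parameter $\sigma^2$, $\sigma>0$, i.e. $\mathbf{E}\, e^{u\xi_i} \le e^{\sigma^2u^2/2}$ for all $u \in \mathbb{R}$. Write $\mathrm{supp}(\beta)=\{j:\beta_j\ne 0\}$, $\|\beta\|_0=|\mathrm{supp}(\beta)|$ and $S^*=\mathrm{supp}(\beta^*)$. For an integer $s^*\ge 1$ and $\lambda \in \mathbb{R}$ let $$\Omega^p_{s^*,\lambda}=\{\beta^*\in\mathbb{R}^p : \|\beta^*\|_0 = s^*,\ \min_{i\in S^*}|\beta^*_i|\ge\lambda\}.$$ Let $s = s^*+\tau$ with an integer $\tau\in[0,3s^*]$. Given an initial vector $\beta^0$ (possibly depending on the data), hard thresholding pursuit (HTP) with model size $s$ produces $\beta^1,\beta^2,\dots$ as follows: $S^{t+1}$ is the support of the vector obtained from $\beta^t + X^\top(y-X\beta^t)/n$ by setting all but its $s$ entries of largest absolute value to zero (ties broken arbitrarily), and $\beta^{t+1}$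 minimizes $\|y-X\beta\|_2$ over the $\beta$ with $\mathrm{supp}(\beta)\subseteq S^{t+1}$. The oracle least-squares estimator $\tilde\beta^*$ is $\tilde\beta^*_{S^*}=(X_{S^*}^\top X_{S^*})^{-1}X_{S^*}^\top y$, $\tilde\beta^*_{(S^*)^c}=0$. Let $0<\epsilon<1$. There are constants $C_{2,\epsilon},C_{3,\epsilon}>0$ depending only on $\epsilon$, and for every $C>0$ a constant $C_{1,\epsilon}>0$ depending only on $\epsilon$ and $C$, such that the following holds. Assume that 1. $X$ satisfies the restricted isometry property of order $3s$ with a constant $\delta_{3s}\in(0,1)$, that is, $1-\delta_{3s}\le \|X_Su\|_2^2/(n\|u\|_2^2)\le 1+\delta_{3s}$ for all $S\subseteq\{1,\dots,p\}$ with $|S|\le 3s$ and all $0\ne u\in\mathbb{R}^{|S|}$, and $\delta_{3s}<\min(\epsilon^2, 0.005)$; 2. $n\ge C_0 s_{\max}\log(p/s_{\max})$ for some constant $C_0>0$ and some integer $s_{\max}\ge s$; 3. $\lambda\ge(1+3\epsilon)\sigma\{2\log(p/s^*)/n\}^{1/2}$ and $\lambda\ge(2+2\epsilon)\sigma(2\log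 p/n)^{1/2}$; 4. $\|\beta^0-\beta^*\|_2\le C\sigma\{s^*\log(p/s^*)/n\}^{1/2}$ and $\|\beta^0\|_0\le s$ almost surely. Then, for every $t\ge 0$, $$\sup_{\beta^*\in\Omega^p_{s^*,\lambda}}\mathrm{pr}\left\{\|\beta^t-\tilde\beta^*\|_2\ge\left(\tfrac{9}{10}\right)^tC_{1,\epsilon}\,\sigma\left(\frac{s^*\log p}{n}\right)^{1/2}+C_{2,\epsilon}\,\sigma\left(\frac{2\tau\log p}{n}\right)^{1/2}\right\}\le\left(\frac{s^*}{p}\right)^{C_{3,\epsilon}}.$$ Moreover, if $s=s^*$ (that is, $\tau=0$), then for every $\beta^*\in\Omega^p_{s^*,\lambda}$ we have $\beta^t\to\tilde\beta^*$ as $t\to\infty$ with probability at least $1-(s^*/p)^{C_{3,\epsilon}}$. -/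

import Mathlib

open MeasureTheory ProbabilityTheory Filter Topology
open scoped Matrix

noncomputable section

namespace HTP

/-- The Euclidean norm of a finite real vector. -/
def l2 {ι : Type*} [Fintype ι] (v : ι → ℝ) : ℝ := ‖WithLp.toLp 2 v‖

/-- The support `{j : β_j ≠ 0}`. -/
def supp {p : ℕ} (β : Fin p → ℝ) : Finset (Fin p) := Finset.univ.filter (fun j => β j ≠ 0)

/-- The submatrix `X_S` of the columns of `X` listed in `S`. -/
def cols {n p : ℕ} (X : Matrix (Fin n) (Fin p) ℝ) (S : Finset (Fin p)) : Matrix (Fin n) S ℝ :=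
  X.submatrix id (fun j : S => (j : Fin p))

/-- The restricted isometry property `RIP(k, δ)`. -/
def RIP {n p : ℕ} (X : Matrix (Fin n) (Fin p) ℝ) (k : ℕ) (δ : ℝ) : Prop :=
  0 < δ ∧ δ < 1 ∧
    ∀ S : Finset (Fin p), S.card ≤ k → ∀ u : S → ℝ, u ≠ 0 →
      1 - δ ≤ l2 (cols X S *ᵥ u) ^ 2 / (n * l2 u ^ 2) ∧
        l2 (cols X S *ᵥ u) ^ 2 / (n * l2 u ^ 2) ≤ 1 + δ

/-- Every column of `X` has Euclidean norm `√n`. -/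
def NormalizedColumns {n p : ℕ} (X : Matrix (Fin n) (Fin p) ℝ) : Prop :=
  ∀ j, l2 (fun i => X i j) = Real.sqrt n

/-- `w` is a hard thresholding `T_s(v)` of `v`: the `s` entries of largest modulus are kept (all of
them if `s ≥ p`; ties are broken arbitrarily), the others are set to zero. -/
def IsHardThreshold {p : ℕ} (s : ℕ) (v w : Fin p → ℝ) : Prop :=
  ∃ T : Finset (Fin p), T.card = min s p ∧ (∀ i ∈ T, ∀ j ∉ T, |v j| ≤ |v i|) ∧
    ∀ j, w j = if j ∈ T then v j else 0

/-- `β` is a least-squares solution among the vectors supported in `S`. -/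
def IsLeastSquaresOn {n p : ℕ} (X : Matrix (Fin n) (Fin p) ℝ) (y : Fin n → ℝ)
    (S : Finset (Fin p)) (β : Fin p → ℝ) : Prop :=
  supp β ⊆ S ∧ ∀ b : Fin p → ℝ, supp b ⊆ S → l2 (y - X *ᵥ β) ≤ l2 (y - X *ᵥ b)

/-- One iteration of hard thresholding pursuit, from `β` to `β'`: a unit gradient step, hard
thresholding, and a least-squares fit on the support so found. -/
def IsStep {n p : ℕ} (X : Matrix (Fin n) (Fin p) ℝ) (y : Fin n → ℝ) (s : ℕ)
    (β β' : Fin p → ℝ) : Prop :=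
  ∃ w : Fin p → ℝ,
    IsHardThreshold s (β + (n : ℝ)⁻¹ • (Xᵀ *ᵥ (y - X *ᵥ β))) w ∧
      IsLeastSquaresOn X y (supp w) β'

/-- The least-squares estimator on `S`: `(X_Sᵀ X_S)⁻¹ X_Sᵀ y` on `S` and zero off `S`. -/
def olsOn {n p : ℕ} (X : Matrix (Fin n) (Fin p) ℝ) (S : Finset (Fin p)) (y : Fin n → ℝ) :
    Fin p → ℝ := fun j =>
  if h : j ∈ S then (((cols X S)ᵀ * cols X S)⁻¹ *ᵥ ((cols X S)ᵀ *ᵥ y)) ⟨j, h⟩ else 0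

/-- The class of `k`-sparse signals whose nonzero entries have modulus at least `lam`. -/
def signalClass (p k : ℕ) (lam : ℝ) : Set (Fin p → ℝ) :=
  {β | (supp β).card = k ∧ ∀ i ∈ supp β, lam ≤ |β i|}

/-- The noise: i.i.d., centred, sub-Gaussian with scale parameter (variance proxy) `σ ^ 2`. -/
structure IsNoise {Ω : Type*} [MeasurableSpace Ω] (μ : Measure Ω) {n : ℕ}
    (ξ : Fin n → Ω → ℝ) (σ : ℝ) : Prop where
  indep : iIndepFun ξ μ
  ident : ∀ i j, IdentDistrib (ξ i) (ξ j) μ μ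
  mean_zero : ∀ i, μ[ξ i] = 0
  subgaussian : ∀ i, HasSubgaussianMGF (ξ i) (Real.toNNReal (σ ^ 2)) μ

/-- The response `y = X β* + ξ` at the outcome `ω`. -/
def response {Ω : Type*} {n p : ℕ} (X : Matrix (Fin n) (Fin p) ℝ) (βstar : Fin p → ℝ)
    (ξ : Fin n → Ω → ℝ) (ω : Ω) : Fin n → ℝ := X *ᵥ βstar + fun i => ξ i ω

end HTP

end

/-! Compare the iterates with the oracle `b = olsOn X S y`, not with `βstar`. Let `g` be the score
`Xᵀ(y - Xb)/n`, which vanishes on `S`. The randomness enters through one event: `|g j| + |b i -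
βstar i| ≤ (1 - κ) L` for all `i ∈ S`, `j ∉ S`, where `L` is the second lower bound imposed on the
signal. On it every oracle entry on `S` beats every score off `S` by at least `κ L`.

Deterministic part (`IsStep.l2_sub_le`). With `e = β - b`, the gradient step yields `b + h + g`,
where `h = (I - XᵀX/n) e` is small on sparse sets by RIP. A coordinate of `S` is missed only if `h`
overcomes the margin, so `missed_mass_le` bounds both the mass and the number of misses by `l2 e`.
The normal equations of the refit then control the new error. The cost is `L` per false selection,
and false selections exceed misses by at most `τ`.

Probabilistic part (`measureReal_not_separated_le`). The score `g j` is a functional of the noise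
orthogonal to the columns in `S`, and the error `b i - βstar i` is one inside their span. Their
squared norms therefore add under every choice of signs, and a union bound over pairs suffices. -/

namespace HTP

/-! ### Euclidean norm, supports and restriction to coordinate sets. -/

section Euclidean

variable {ι : Type*} [Fintype ι]

lemma l2_nonneg (v : ι → ℝ) : 0 ≤ l2 v := norm_nonneg _

lemma l2_sq (v : ι → ℝ) : l2 v ^ 2 = ∑ i, v i ^ 2 := by
  simp [l2, EuclideanSpace.real_norm_sq_eq]

lemma l2_sq_eq_dotProduct (v : ι → ℝ) : l2 v ^ 2 = v ⬝ᵥ v := by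
  rw [l2_sq]
  simp [dotProduct, pow_two]

lemma l2_add_le (v w : ι → ℝ) : l2 (v + w) ≤ l2 v + l2 w := by
  simpa [l2] using norm_add_le (WithLp.toLp 2 v) (WithLp.toLp 2 w)

lemma abs_le_l2 (v : ι → ℝ) (i : ι) : |v i| ≤ l2 v := by
  apply abs_le_of_sq_le_sq _ (l2_nonneg v)
  rw [l2_sq]
  exact Finset.single_le_sum (f := fun i => v i ^ 2) (fun _ _ => sq_nonneg _) (Finset.mem_univ i)

end Euclidean

variable {n p : ℕ}

lemma mem_supp {β : Fin p → ℝ} {j : Fin p} : j ∈ supp β ↔ β j ≠ 0 := by simp [supp]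

lemma eq_zero_of_supp_subset {β : Fin p → ℝ} {S : Finset (Fin p)} (h : supp β ⊆ S) {j : Fin p}
    (hj : j ∉ S) : β j = 0 := by
  by_contra h0
  exact hj (h (mem_supp.2 h0))

lemma supp_subset_of {β : Fin p → ℝ} {S : Finset (Fin p)} (h : ∀ j ∉ S, β j = 0) :
    supp β ⊆ S := by
  intro j hj
  by_contra h0
  exact mem_supp.1 hj (h j h0)

lemma supp_sub_subset (u w : Fin p → ℝ) : supp (u - w) ⊆ supp u ∪ supp w := by
  apply supp_subset_of
  intro j hj
  simp only [Finset.mem_union, mem_supp, not_or, not_not] at hj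
  simp [hj.1, hj.2]

lemma mulVec_eq_cols_mulVec (X : Matrix (Fin n) (Fin p) ℝ) {S : Finset (Fin p)} {u : Fin p → ℝ}
    (hu : supp u ⊆ S) : X *ᵥ u = cols X S *ᵥ (fun j : S => u j) := by
  ext i
  simp only [Matrix.mulVec, dotProduct, cols, Matrix.submatrix_apply, id]
  rw [Finset.sum_coe_sort S (fun j => X i j * u j)]
  symm
  apply Finset.sum_subset (Finset.subset_univ S)
  intro j _ hj
  simp [eq_zero_of_supp_subset hu hj]

lemma l2_sq_restrict {S : Finset (Fin p)} {u : Fin p → ℝ} (hu : supp u ⊆ S) :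
    l2 (fun j : S => u j) ^ 2 = l2 u ^ 2 := by
  rw [l2_sq, l2_sq, Finset.sum_coe_sort S (fun j => u j ^ 2)]
  apply Finset.sum_subset (Finset.subset_univ S)
  intro j _ hj
  simp [eq_zero_of_supp_subset hu hj]

/-! ### Consequences of the restricted isometry property. -/

section RIP

variable {X : Matrix (Fin n) (Fin p) ℝ} {k : ℕ} {δ : ℝ}

/-- The two-sided RIP bound on a submatrix, without division. -/
lemma RIP.cols_bounds (hX : RIP X k δ) (hn : 0 < n) {S : Finset (Fin p)} (hS : S.card ≤ k)
    (u : S → ℝ) :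
    (1 - δ) * (n * l2 u ^ 2) ≤ l2 (cols X S *ᵥ u) ^ 2 ∧
      l2 (cols X S *ᵥ u) ^ 2 ≤ (1 + δ) * (n * l2 u ^ 2) := by
  rcases eq_or_ne u 0 with rfl | hu
  · simp [l2_sq]
  obtain ⟨-, -, h⟩ := hX
  obtain ⟨h1, h2⟩ := h S hS u hu
  have hpos : 0 < (n : ℝ) * l2 u ^ 2 := by
    have : 0 < l2 u := by
      simpa [l2] using hu
    positivity
  exact ⟨(le_div_iff₀ hpos).1 h1, (div_le_iff₀ hpos).1 h2⟩

/-- The Gram form `⟨Xu, Xu⟩ / n` is close to the identity on sparse vectors. -/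
lemma RIP.abs_quadratic_le (hX : RIP X k δ) (hn : 0 < n) {S : Finset (Fin p)} (hS : S.card ≤ k)
    {u : Fin p → ℝ} (hu : supp u ⊆ S) :
    |u ⬝ᵥ u - (n : ℝ)⁻¹ * ((X *ᵥ u) ⬝ᵥ (X *ᵥ u))| ≤ δ * (u ⬝ᵥ u) := by
  have h := hX.cols_bounds hn hS (fun j : S => u j)
  rw [← mulVec_eq_cols_mulVec X hu, l2_sq_restrict hu, l2_sq_eq_dotProduct,
    l2_sq_eq_dotProduct] at h
  have hn' : (0 : ℝ) < n := by exact_mod_cast hn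
  set a := u ⬝ᵥ u
  set b := (X *ᵥ u) ⬝ᵥ (X *ᵥ u)
  have h1 : (1 - δ) * a ≤ (n : ℝ)⁻¹ * b := by
    rw [le_inv_mul_iff₀ hn']; linarith [h.1]
  have h2 : (n : ℝ)⁻¹ * b ≤ (1 + δ) * a := by
    rw [inv_mul_le_iff₀ hn']; linarith [h.2]
  rw [abs_le]
  constructor <;> linarith

/-- Polarized form of `RIP.abs_quadratic_le`. -/
lemma RIP.sq_bilinear_le (hX : RIP X k δ) (hn : 0 < n) {S : Finset (Fin p)} (hS : S.card ≤ k)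
    {u w : Fin p → ℝ} (hu : supp u ⊆ S) (hw : supp w ⊆ S) :
    (u ⬝ᵥ w - (n : ℝ)⁻¹ * ((X *ᵥ u) ⬝ᵥ (X *ᵥ w))) ^ 2 ≤ δ ^ 2 * (u ⬝ᵥ u) * (w ⬝ᵥ w) := by
  set B := u ⬝ᵥ w - (n : ℝ)⁻¹ * ((X *ᵥ u) ⬝ᵥ (X *ᵥ w)) with hB
  -- Subtract the quadratic bounds at `t u + w` and `t u - w`: the squares cancel on one side and
  -- leave `4 t B`. Nonnegativity for all `t` bounds the discriminant.
  have key : ∀ t : ℝ, 0 ≤ (δ * (u ⬝ᵥ u)) * (t * t) + (-2 * B) * t + δ * (w ⬝ᵥ w) := by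
    intro t
    have hsp : ∀ c : ℝ, supp (t • u + c • w) ⊆ S := fun c => supp_subset_of fun j hj => by
      simp [eq_zero_of_supp_subset hu hj, eq_zero_of_supp_subset hw hj]
    have h1 := hX.abs_quadratic_le hn hS (hsp 1)
    have h2 := hX.abs_quadratic_le hn hS (hsp (-1))
    simp only [Matrix.mulVec_add, Matrix.mulVec_smul, add_dotProduct, dotProduct_add,
      smul_dotProduct, dotProduct_smul, smul_eq_mul, dotProduct_comm w u,
      dotProduct_comm (X *ᵥ w) (X *ᵥ u)] at h1 h2
    have h1' := (abs_le.1 h1).2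
    have h2' := (abs_le.1 h2).1
    linarith
  have := discrim_le_zero key
  rw [discrim] at this
  nlinarith

/-- The map `I - XᵀX/n` contracts sparse vectors by the factor `δ` on small coordinate sets. -/
lemma RIP.sum_residual_sq_le (hX : RIP X k δ) (hn : 0 < n) {e : Fin p → ℝ} {T : Finset (Fin p)}
    (hT : (supp e ∪ T).card ≤ k) :
    ∑ i ∈ T, (e - (n : ℝ)⁻¹ • (Xᵀ *ᵥ (X *ᵥ e))) i ^ 2 ≤ (δ * l2 e) ^ 2 := by
  set h := e - (n : ℝ)⁻¹ • (Xᵀ *ᵥ (X *ᵥ e)) with hh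
  -- Testing the bilinear bound against the truncation of `h` to `T` gives `A ^ 2 ≤ (δ * l2 e) ^ 2 *
  -- A` for the sum `A` to be bounded.
  set w : Fin p → ℝ := fun i => if i ∈ T then h i else 0 with hw
  have hws : supp w ⊆ supp e ∪ T := (supp_subset_of fun j hj => by simp [hw, hj]).trans
    Finset.subset_union_right
  have hB := hX.sq_bilinear_le hn hT Finset.subset_union_left hws
  have hdot : ∀ v : Fin p → ℝ, v ⬝ᵥ w = ∑ i ∈ T, v i * h i := by
    intro v
    simp [dotProduct, hw, Finset.sum_ite_mem]
  have h1 : e ⬝ᵥ w - (n : ℝ)⁻¹ * ((X *ᵥ e) ⬝ᵥ (X *ᵥ w)) = ∑ i ∈ T, h i ^ 2 := by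
    have : e ⬝ᵥ w - (n : ℝ)⁻¹ * ((X *ᵥ e) ⬝ᵥ (X *ᵥ w)) = h ⬝ᵥ w := by
      rw [hh, sub_dotProduct, smul_dotProduct, smul_eq_mul, Matrix.dotProduct_mulVec,
        Matrix.mulVec_transpose]
    rw [this, hdot]
    simp [pow_two]
  have h2 : w ⬝ᵥ w = ∑ i ∈ T, h i ^ 2 := by
    rw [hdot]
    exact Finset.sum_congr rfl fun i hi => by simp [hw, hi, pow_two]
  rw [h1, h2, ← l2_sq_eq_dotProduct] at hB
  have h0 : 0 ≤ ∑ i ∈ T, h i ^ 2 := Finset.sum_nonneg fun _ _ => sq_nonneg _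
  rcases h0.eq_or_lt with h0 | h0
  · rw [← h0]; positivity
  · nlinarith

end RIP

/-- Normal equations of a least-squares fit. -/
lemma IsLeastSquaresOn.normal_eq {X : Matrix (Fin n) (Fin p) ℝ} {y : Fin n → ℝ}
    {S : Finset (Fin p)} {β : Fin p → ℝ} (h : IsLeastSquaresOn X y S β) {j : Fin p}
    (hj : j ∈ S) : (Xᵀ *ᵥ (y - X *ᵥ β)) j = 0 := by
  set r := y - X *ᵥ β with hr
  set x : Fin n → ℝ := X *ᵥ (Pi.single j 1) with hx
  have hrx : (Xᵀ *ᵥ r) j = r ⬝ᵥ x := by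
    rw [hx, Matrix.dotProduct_mulVec, Matrix.mulVec_transpose, dotProduct_single, mul_one]
  -- Minimality along the line `β + t e_j` is a nonnegative quadratic in `t` without constant term,
  -- so its linear coefficient vanishes.
  have key : ∀ t : ℝ, 0 ≤ (x ⬝ᵥ x) * (t * t) + (-2 * (r ⬝ᵥ x)) * t + 0 := by
    intro t
    have h1 := h.2 (β + t • Pi.single j 1) (supp_subset_of fun i hi => by
      have : i ≠ j := fun hij => hi (hij ▸ hj)
      simp [eq_zero_of_supp_subset h.1 hi, this])
    have h2 := pow_le_pow_left₀ (l2_nonneg _) h1 2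
    rw [Matrix.mulVec_add, Matrix.mulVec_smul, ← sub_sub, ← hr, ← hx, l2_sq_eq_dotProduct,
      l2_sq_eq_dotProduct] at h2
    simp only [sub_dotProduct, dotProduct_sub, smul_dotProduct, dotProduct_smul, smul_eq_mul,
      dotProduct_comm x r] at h2
    linarith
  have := discrim_le_zero key
  rw [discrim] at this
  rw [hrx]
  nlinarith

/-! ### The oracle: normal equations and linear functionals of the noise. -/

section OLS

variable {X : Matrix (Fin n) (Fin p) ℝ} {S : Finset (Fin p)}

lemma supp_olsOn_subset (X : Matrix (Fin n) (Fin p) ℝ) (S : Finset (Fin p)) (y : Fin n → ℝ) :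
    supp (olsOn X S y) ⊆ S := supp_subset_of fun j hj => by simp [olsOn, hj]

lemma mulVec_olsOn (X : Matrix (Fin n) (Fin p) ℝ) (S : Finset (Fin p)) (y : Fin n → ℝ) :
    X *ᵥ olsOn X S y =
      cols X S *ᵥ (((cols X S)ᵀ * cols X S)⁻¹ *ᵥ ((cols X S)ᵀ *ᵥ y)) := by
  rw [mulVec_eq_cols_mulVec X (supp_olsOn_subset X S y)]
  congr 1
  ext j
  simp [olsOn]

lemma RIP.isUnit_det_gram {k : ℕ} {δ : ℝ} (hX : RIP X k δ) (hn : 0 < n) (hS : S.card ≤ k) :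
    IsUnit ((cols X S)ᵀ * cols X S).det := by
  rw [← Matrix.isUnit_iff_isUnit_det, ← Matrix.mulVec_injective_iff_isUnit]
  rw [← Matrix.coe_mulVecLin, ← LinearMap.ker_eq_bot, LinearMap.ker_eq_bot']
  intro u hu
  rw [Matrix.mulVecLin_apply] at hu
  have h1 : l2 (cols X S *ᵥ u) ^ 2 = 0 := by
    rw [l2_sq_eq_dotProduct, Matrix.dotProduct_mulVec, ← Matrix.mulVec_transpose,
      Matrix.mulVec_mulVec, hu, zero_dotProduct]
  have h2 := (hX.cols_bounds hn hS u).1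
  have hδ := hX.2.1
  have hn' : (0 : ℝ) < n := by exact_mod_cast hn
  have h3 : l2 u ^ 2 ≤ 0 := by
    by_contra h
    push Not at h
    have : 0 < (1 - δ) * (n * l2 u ^ 2) := mul_pos (by linarith) (by positivity)
    linarith
  have : l2 u = 0 := by nlinarith [l2_nonneg u]
  simpa [l2] using this

/-- The residual of the least-squares estimator is orthogonal to the columns in `S`. -/
lemma cols_transpose_mulVec_residual (hG : IsUnit ((cols X S)ᵀ * cols X S).det)
    (v : Fin n → ℝ) :
    (cols X S)ᵀ *ᵥ (v - cols X S *ᵥ (((cols X S)ᵀ * cols X S)⁻¹ *ᵥ ((cols X S)ᵀ *ᵥ v))) = 0 := by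
  rw [Matrix.mulVec_sub, Matrix.mulVec_mulVec, Matrix.mulVec_mulVec, Matrix.mul_nonsing_inv _ hG,
    Matrix.one_mulVec, sub_self]

lemma olsOn_normal_eq (hG : IsUnit ((cols X S)ᵀ * cols X S).det) (y : Fin n → ℝ) {i : Fin p}
    (hi : i ∈ S) : (Xᵀ *ᵥ (y - X *ᵥ olsOn X S y)) i = 0 := by
  have h := congrFun (cols_transpose_mulVec_residual hG y) ⟨i, hi⟩
  rw [← mulVec_olsOn] at h
  simpa [Matrix.mulVec, dotProduct, cols] using h

/-- The estimation error of a coordinate of the oracle is a linear functional of the noise whose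
coefficients lie in the span of the columns in `S`. -/
lemma RIP.exists_olsOn_error {k : ℕ} {δ : ℝ} (hX : RIP X k δ) (hn : 0 < n) (hS : S.card ≤ k)
    {βstar : Fin p → ℝ} (hβ : supp βstar ⊆ S) {i : Fin p} (hi : i ∈ S) :
    ∃ u : S → ℝ, (cols X S *ᵥ u) ⬝ᵥ (cols X S *ᵥ u) ≤ ((1 - δ) * n)⁻¹ ∧
      ∀ z : Fin n → ℝ, olsOn X S (X *ᵥ βstar + z) i - βstar i = (cols X S *ᵥ u) ⬝ᵥ z := by
  have hG := hX.isUnit_det_gram hn hS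
  set G := (cols X S)ᵀ * cols X S with hGdef
  have hGT : Gᵀ = G := by simp [hGdef, Matrix.transpose_mul]
  have hGiT : (G⁻¹)ᵀ = G⁻¹ := by rw [Matrix.transpose_nonsing_inv, hGT]
  set u : S → ℝ := G⁻¹ *ᵥ Pi.single ⟨i, hi⟩ 1 with hu
  have hlin : ∀ v : S → ℝ, (G⁻¹ *ᵥ v) ⟨i, hi⟩ = u ⬝ᵥ v := by
    intro v
    rw [hu, dotProduct_comm, Matrix.dotProduct_mulVec, dotProduct_single, mul_one,
      ← Matrix.mulVec_transpose, hGiT]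
  refine ⟨u, ?_, fun z => ?_⟩
  -- As `u` is a column of the inverse Gram matrix, its quadratic form equals its own entry `a` at
  -- `i`. RIP then reads `(1 - δ) n a ^ 2 ≤ a`.
  · have h1 : (cols X S *ᵥ u) ⬝ᵥ (cols X S *ᵥ u) = u ⟨i, hi⟩ := by
      rw [Matrix.dotProduct_mulVec, ← Matrix.mulVec_transpose, Matrix.mulVec_mulVec, ← hGdef, hu,
        Matrix.mulVec_mulVec, Matrix.mul_nonsing_inv _ hG, Matrix.one_mulVec,
        single_dotProduct, one_mul]
    have h2 := (hX.cols_bounds hn hS u).1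
    rw [l2_sq_eq_dotProduct (cols X S *ᵥ u), h1] at h2
    rw [h1]
    have h3 : u ⟨i, hi⟩ ^ 2 ≤ l2 u ^ 2 := sq_le_sq.2 (by
      rw [abs_of_nonneg (l2_nonneg u)]; exact abs_le_l2 u _)
    have hpos : 0 < (1 - δ) * n := mul_pos (by linarith [hX.2.1]) (by exact_mod_cast hn)
    rw [← one_div, le_div_iff₀ hpos]
    set a := u ⟨i, hi⟩
    have h4 : (1 - δ) * n * a ^ 2 ≤ a := by nlinarith
    by_contra hc
    push Not at hc
    have ha : 0 < a := by
      by_contra ha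
      push Not at ha
      nlinarith
    nlinarith
  · simp only [olsOn, hi, dif_pos]
    rw [Matrix.mulVec_add, mulVec_eq_cols_mulVec X hβ, Matrix.mulVec_mulVec, Matrix.mulVec_add,
      Matrix.mulVec_mulVec, ← hGdef, Matrix.nonsing_inv_mul _ hG, Matrix.one_mulVec, Pi.add_apply,
      hlin, Matrix.dotProduct_mulVec, Matrix.vecMul_transpose]
    ring

/-- The score of a column at the oracle is a linear functional of the noise whose coefficients are
orthogonal to the columns in `S`. -/
lemma exists_olsOn_score (hn : 0 < n) (hcol : NormalizedColumns X)
    (hG : IsUnit ((cols X S)ᵀ * cols X S).det)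
    {βstar : Fin p → ℝ} (hβ : supp βstar ⊆ S) (j : Fin p) :
    ∃ a : Fin n → ℝ, a ⬝ᵥ a ≤ (n : ℝ)⁻¹ ∧ (∀ u : S → ℝ, a ⬝ᵥ (cols X S *ᵥ u) = 0) ∧
      ∀ z : Fin n → ℝ,
        (n : ℝ)⁻¹ * (Xᵀ *ᵥ (X *ᵥ βstar + z - X *ᵥ olsOn X S (X *ᵥ βstar + z))) j = a ⬝ᵥ z := by
  set G := (cols X S)ᵀ * cols X S with hGdef
  have hGT : Gᵀ = G := by simp [hGdef, Matrix.transpose_mul]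
  have hGiT : (G⁻¹)ᵀ = G⁻¹ := by rw [Matrix.transpose_nonsing_inv, hGT]
  set x : Fin n → ℝ := fun i => X i j with hx
  set q : S → ℝ := G⁻¹ *ᵥ ((cols X S)ᵀ *ᵥ x) with hq
  -- Residual of column `j` after projection onto the span of the columns in `S`; by Pythagoras it
  -- is no longer than the column.
  set r : Fin n → ℝ := x - cols X S *ᵥ q with hr
  have hn' : (0 : ℝ) < n := by exact_mod_cast hn
  have horth : ∀ u : S → ℝ, r ⬝ᵥ (cols X S *ᵥ u) = 0 := by
    intro u
    rw [Matrix.dotProduct_mulVec, ← Matrix.mulVec_transpose, hr, hq, hGdef,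
      cols_transpose_mulVec_residual hG, zero_dotProduct]
  have hxx : x ⬝ᵥ x = n := by
    rw [← l2_sq_eq_dotProduct, hx, hcol j, Real.sq_sqrt hn'.le]
  have hrr : r ⬝ᵥ r ≤ n := by
    have hsum : x = r + cols X S *ᵥ q := by rw [hr]; abel
    have h0 : 0 ≤ (cols X S *ᵥ q) ⬝ᵥ (cols X S *ᵥ q) := by
      rw [← l2_sq_eq_dotProduct]; positivity
    have h1 := hxx
    rw [hsum, add_dotProduct, dotProduct_add, dotProduct_add, horth,
      dotProduct_comm (cols X S *ᵥ q) r, horth] at h1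
    linarith
  refine ⟨(n : ℝ)⁻¹ • r, ?_, fun u => ?_, fun z => ?_⟩
  · rw [smul_dotProduct, dotProduct_smul, smul_eq_mul, smul_eq_mul]
    calc (n : ℝ)⁻¹ * ((n : ℝ)⁻¹ * (r ⬝ᵥ r)) ≤ (n : ℝ)⁻¹ * ((n : ℝ)⁻¹ * n) := by gcongr
      _ = (n : ℝ)⁻¹ := by field_simp
  · rw [smul_dotProduct, horth, smul_zero]
  · rw [smul_dotProduct, smul_eq_mul]
    congr 1
    have h1 : (Xᵀ *ᵥ (X *ᵥ βstar + z - X *ᵥ olsOn X S (X *ᵥ βstar + z))) j =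
        x ⬝ᵥ (X *ᵥ βstar + z - X *ᵥ olsOn X S (X *ᵥ βstar + z)) := rfl
    have h2 : x ⬝ᵥ (cols X S *ᵥ (G⁻¹ *ᵥ ((cols X S)ᵀ *ᵥ (X *ᵥ βstar + z)))) =
        (cols X S *ᵥ q) ⬝ᵥ (X *ᵥ βstar + z) := by
      rw [hq, Matrix.dotProduct_mulVec, Matrix.dotProduct_mulVec, Matrix.dotProduct_mulVec,
        Matrix.vecMul_transpose]
      congr 2
      rw [← Matrix.mulVec_transpose, hGiT, ← Matrix.mulVec_transpose]
    rw [h1, mulVec_olsOn, dotProduct_sub, h2, ← sub_dotProduct, ← hr, dotProduct_add,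
      mulVec_eq_cols_mulVec X hβ, horth, zero_add]

end OLS

/-! ### Deterministic contraction of one iteration. -/

lemma exists_injOn_of_card_le {α : Type*} [DecidableEq α] {A B : Finset α}
    (h : A.card ≤ B.card) : ∃ φ : α → α, (∀ a ∈ A, φ a ∈ B) ∧ Set.InjOn φ A := by
  obtain ⟨f⟩ : Nonempty (A ↪ B) := Function.Embedding.nonempty_of_card_le (by simpa using h)
  refine ⟨fun a => if ha : a ∈ A then f ⟨a, ha⟩ else a, fun a ha => by simp [ha], ?_⟩
  intro a ha b hb hab
  have ha' : a ∈ A := ha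
  have hb' : b ∈ A := hb
  simp only [ha', hb', dif_pos] at hab
  simpa using f.injective (Subtype.ext hab)

/-- The norm of a vector is at most the sum of the norms of its parts on `A` and off `A`. -/
lemma l2_le_of_sum_sq_le {v : Fin p → ℝ} (A : Finset (Fin p)) {a b : ℝ} (ha : 0 ≤ a) (hb : 0 ≤ b)
    (h1 : ∑ i ∈ A, v i ^ 2 ≤ a ^ 2) (h2 : ∑ i ∈ Aᶜ, v i ^ 2 ≤ b ^ 2) : l2 v ≤ a + b := by
  apply le_of_sq_le_sq _ (by positivity)
  rw [l2_sq, ← Finset.sum_add_sum_compl A]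
  nlinarith [mul_nonneg ha hb]

/-- Minkowski's inequality on a coordinate set. -/
lemma sum_add_sq_le {A : Finset (Fin p)} {u w : Fin p → ℝ} {a b : ℝ} (ha : 0 ≤ a) (hb : 0 ≤ b)
    (hu : ∑ i ∈ A, u i ^ 2 ≤ a ^ 2) (hw : ∑ i ∈ A, w i ^ 2 ≤ b ^ 2) :
    ∑ i ∈ A, (u i + w i) ^ 2 ≤ (a + b) ^ 2 := by
  have hcs := Finset.sum_mul_sq_le_sq_mul_sq A u w
  have h1 : ∑ i ∈ A, u i * w i ≤ a * b := by
    apply le_of_sq_le_sq _ (by positivity)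
    calc (∑ i ∈ A, u i * w i) ^ 2 ≤ (∑ i ∈ A, u i ^ 2) * ∑ i ∈ A, w i ^ 2 := hcs
      _ ≤ a ^ 2 * b ^ 2 := by
        apply mul_le_mul hu hw (Finset.sum_nonneg fun _ _ => sq_nonneg _) (sq_nonneg _)
      _ = (a * b) ^ 2 := by ring
  have h2 : ∑ i ∈ A, (u i + w i) ^ 2 =
      ∑ i ∈ A, u i ^ 2 + 2 * ∑ i ∈ A, u i * w i + ∑ i ∈ A, w i ^ 2 := by
    rw [Finset.mul_sum, ← Finset.sum_add_distrib, ← Finset.sum_add_distrib]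
    exact Finset.sum_congr rfl fun i _ => by ring
  rw [h2]
  nlinarith

/-- Coordinates of `S` that hard thresholding of `b + h + g` misses carry little of the mass of
`b`, provided `b` dominates `g` on `S` by a margin `κ L`. -/
lemma missed_mass_le {S T M : Finset (Fin p)} {b h g : Fin p → ℝ} {κ L D : ℝ} (hκ : 0 < κ)
    (hκ1 : κ ≤ 1) (hL : 0 ≤ L) (hScard : S.card ≤ T.card) (hSp : ∃ j, j ∉ S)
    (hgS : ∀ i ∈ S, g i = 0) (hbS : ∀ j ∉ S, b j = 0)
    (hsep : ∀ i ∈ S, ∀ j ∉ S, |g j| + κ * L ≤ |b i|) (hgL : ∀ j ∉ S, |g j| ≤ (1 - κ) * L)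
    (htop : ∀ i ∈ T, ∀ j ∉ T, |(b + h + g) j| ≤ |(b + h + g) i|)
    (hM : M ⊆ S) (hMT : ∀ i ∈ M, i ∈ T → (b + h + g) i = 0)
    (hMc : S \ T ⊆ M)
    (hD : ∑ i ∈ S ∪ T, h i ^ 2 ≤ D ^ 2) :
    κ ^ 2 * ∑ i ∈ M, b i ^ 2 ≤ 2 * D ^ 2 ∧ M.card * (κ * L) ^ 2 ≤ 2 * D ^ 2 := by
  have hcard : (S \ T).card ≤ (T \ S).card := by
    have h1 := Finset.card_sdiff_add_card_inter S T
    have h2 := Finset.card_sdiff_add_card_inter T S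
    rw [Finset.inter_comm] at h2
    omega
  obtain ⟨φ, hφ, hinj⟩ := exists_injOn_of_card_le hcard
  -- Each coordinate of `S` left out of `T` is charged to its own intruder `φ i ∈ T \ S`, whose
  -- thresholded entry is at least as large.
  set ψ : Fin p → ℝ := fun i => if i ∈ S \ T then |h (φ i)| else 0 with hψ
  have hψ0 : ∀ i, 0 ≤ ψ i := fun i => by simp only [hψ]; split_ifs <;> positivity
  have hκL : 0 ≤ κ * L := by positivity
  have hpt : ∀ i ∈ M, κ * L ≤ |h i| + ψ i ∧ κ * |b i| ≤ |h i| + ψ i := by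
    intro i hi
    have hiS := hM hi
    -- A coordinate may be selected and still be missed, when its entry is exactly zero; then `h i`
    -- alone cancels `b i`.
    by_cases hiT : i ∈ T
    · have h0 := hMT i hi hiT
      simp only [Pi.add_apply, hgS i hiS, add_zero] at h0
      have h1 : |b i| = |h i| := by
        rw [show b i = - h i by linarith, abs_neg]
      have h2 : ψ i = 0 := by simp [hψ, hiT]
      obtain ⟨j, hj⟩ := hSp
      have h3 := hsep i hiS j hj
      have h4 := abs_nonneg (g j)
      rw [h2, add_zero, ← h1]
      exact ⟨by linarith, mul_le_of_le_one_left (abs_nonneg _) hκ1⟩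
    · have hmem : i ∈ S \ T := by simp [hiS, hiT]
      have hj := hφ i hmem
      rw [Finset.mem_sdiff] at hj
      have h2 : ψ i = |h (φ i)| := by simp [hψ, hiS, hiT]
      have h3 := hsep i hiS _ hj.2
      have h5 := hgL _ hj.2
      have h6 := htop _ hj.1 i hiT
      simp only [Pi.add_apply, hgS i hiS, add_zero, hbS _ hj.2, zero_add] at h6
      have h7 := abs_add_le (h (φ i)) (g (φ i))
      have h8 : |b i| ≤ |b i + h i| + |h i| := by
        simpa using abs_sub (b i + h i) (h i)
      rw [h2]
      have h9 : κ * L ≤ |h i| + |h (φ i)| := by linarith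
      refine ⟨h9, ?_⟩
      -- Take `κ` times this bound plus `1 - κ` times `h9`: the terms in `L` cancel.
      have h10 : |b i| ≤ |h i| + |h (φ i)| + (1 - κ) * L := by linarith
      have h11 := mul_le_mul_of_nonneg_left h10 hκ.le
      have h12 := mul_le_mul_of_nonneg_left h9 (sub_nonneg.2 hκ1)
      linarith
  have hsum : ∑ i ∈ M, (|h i| + ψ i) ^ 2 ≤ 2 * D ^ 2 := by
    have h1 : ∑ i ∈ M, (|h i| + ψ i) ^ 2 ≤ 2 * (∑ i ∈ M, h i ^ 2 + ∑ i ∈ M, ψ i ^ 2) := by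
      rw [← Finset.sum_add_distrib, Finset.mul_sum]
      refine Finset.sum_le_sum fun i _ => ?_
      have := sq_nonneg (|h i| - ψ i)
      nlinarith [sq_abs (h i)]
    have h2 : ∑ i ∈ M, ψ i ^ 2 = ∑ i ∈ S \ T, h (φ i) ^ 2 := by
      rw [← Finset.sum_subset hMc]
      · exact Finset.sum_congr rfl fun i hi => by simp [hψ, Finset.mem_sdiff.1 hi]
      · intro i _ hi
        simp only [hψ, hi, if_false]; norm_num
    have h3 : ∑ i ∈ S \ T, h (φ i) ^ 2 ≤ ∑ j ∈ T \ S, h j ^ 2 := by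
      rw [← Finset.sum_image (f := fun j => h j ^ 2) hinj]
      exact Finset.sum_le_sum_of_subset_of_nonneg (Finset.image_subset_iff.2 hφ)
        fun _ _ _ => sq_nonneg _
    have h4 : ∑ i ∈ M, h i ^ 2 ≤ ∑ i ∈ S, h i ^ 2 :=
      Finset.sum_le_sum_of_subset_of_nonneg hM fun _ _ _ => sq_nonneg _
    have h5 : ∑ i ∈ S ∪ T, h i ^ 2 = ∑ i ∈ S, h i ^ 2 + ∑ j ∈ T \ S, h j ^ 2 := by
      rw [← Finset.sum_union Finset.disjoint_sdiff, Finset.union_sdiff_self_eq_union]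
    linarith
  constructor
  · refine le_trans ?_ hsum
    rw [Finset.mul_sum]
    refine Finset.sum_le_sum fun i hi => ?_
    rw [← sq_abs (b i), ← mul_pow]
    exact pow_le_pow_left₀ (by positivity) (hpt i hi).2 2
  · refine le_trans ?_ hsum
    rw [← nsmul_eq_mul]
    exact Finset.card_nsmul_le_sum _ _ _ fun i hi =>
      pow_le_pow_left₀ hκL (hpt i hi).1 2

/-- One iteration of hard thresholding pursuit contracts the distance to a vector `b` that solves
the normal equations on `S` and whose entries there dominate the remaining score. -/
lemma IsStep.l2_sub_le {X : Matrix (Fin n) (Fin p) ℝ} {y : Fin n → ℝ} {τ : ℕ}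
    {S : Finset (Fin p)} {b β β' : Fin p → ℝ} {κ L δ : ℝ}
    (hstep : IsStep X y (S.card + τ) β β')
    (hX : RIP X (3 * (S.card + τ)) δ) (hn : 0 < n) (hκ : 0 < κ) (hκ1 : κ ≤ 1)
    (hδκ : 4 * δ ≤ κ) (hδ : δ ≤ 0.005) (hL : 0 ≤ L)
    (hb : supp b ⊆ S) (hSp : ∃ j, j ∉ S)
    (hgS : ∀ i ∈ S, (Xᵀ *ᵥ (y - X *ᵥ b)) i = 0)
    (hsep : ∀ i ∈ S, ∀ j ∉ S, |(n : ℝ)⁻¹ * (Xᵀ *ᵥ (y - X *ᵥ b)) j| + κ * L ≤ |b i|)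
    (hgL : ∀ j ∉ S, |(n : ℝ)⁻¹ * (Xᵀ *ᵥ (y - X *ᵥ b)) j| ≤ (1 - κ) * L)
    (hβ : (supp β).card ≤ S.card + τ) :
    l2 (β' - b) ≤ 9 / 10 * l2 (β - b) + 2 * L * Real.sqrt τ ∧
      (supp β').card ≤ S.card + τ := by
  obtain ⟨w, ⟨T, hTcard, htop, hw⟩, hls⟩ := hstep
  set g : Fin p → ℝ := (n : ℝ)⁻¹ • (Xᵀ *ᵥ (y - X *ᵥ b)) with hg
  set e := β - b with he
  set e' := β' - b with he'
  set h : Fin p → ℝ := e - (n : ℝ)⁻¹ • (Xᵀ *ᵥ (X *ᵥ e)) with hh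
  set h' : Fin p → ℝ := e' - (n : ℝ)⁻¹ • (Xᵀ *ᵥ (X *ᵥ e')) with hh'
  have hgS' : ∀ i ∈ S, g i = 0 := fun i hi => by simp [hg, hgS i hi]
  have hv : β + (n : ℝ)⁻¹ • (Xᵀ *ᵥ (y - X *ᵥ β)) = b + h + g := by
    rw [hh, hg, he]
    simp only [Matrix.mulVec_sub, smul_sub]
    abel
  rw [hv] at htop hw
  have hTle : T.card ≤ S.card + τ := hTcard.trans_le (min_le_left _ _)
  have hSle : S.card ≤ T.card := by
    rw [hTcard]
    exact le_min (Nat.le_add_right _ _) (by simpa using S.card_le_univ)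
  have hwT : supp w ⊆ T := supp_subset_of fun j hj => by rw [hw j, if_neg hj]
  have hδ0 : 0 < δ := hX.1
  have hD : ∑ i ∈ S ∪ T, h i ^ 2 ≤ (δ * l2 e) ^ 2 := by
    apply hX.sum_residual_sq_le hn
    have h1 : supp e ∪ (S ∪ T) ⊆ supp β ∪ (S ∪ T) := by
      refine Finset.union_subset ?_ Finset.subset_union_right
      refine (supp_sub_subset β b).trans (Finset.union_subset_union_right ?_)
      exact hb.trans Finset.subset_union_left
    have h2 := Finset.card_le_card h1
    have h3 := Finset.card_union_le (supp β) (S ∪ T)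
    have h4 := Finset.card_union_le S T
    omega
  set M := S \ supp w with hM
  obtain ⟨hmass, hcount⟩ := missed_mass_le (M := M) hκ hκ1 hL hSle hSp hgS'
    (fun j hj => eq_zero_of_supp_subset hb hj) hsep hgL htop Finset.sdiff_subset
    (fun i hi hiT => by
      have h1 := (Finset.mem_sdiff.1 hi).2
      rw [mem_supp, not_not, hw i, if_pos hiT] at h1
      exact h1)
    (Finset.sdiff_subset_sdiff le_rfl hwT) hD
  set E := l2 e with hE
  set E' := l2 e' with hE'
  have hE0 : 0 ≤ E := l2_nonneg _
  have hE'0 : 0 ≤ E' := l2_nonneg _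
  -- Missed mass is at most `2 (δ E / κ) ^ 2`, and `4 δ ≤ κ` turns this into `Q ^ 2`.
  set Q : ℝ := Real.sqrt 2 * E / 4 with hQ
  have hQ0 : 0 ≤ Q := by positivity
  have hδQ : 2 * (δ * E) ^ 2 ≤ κ ^ 2 * Q ^ 2 := by
    have h1 : κ ^ 2 * Q ^ 2 = 2 * (κ / 4 * E) ^ 2 := by
      rw [hQ, div_pow, mul_pow, Real.sq_sqrt (by norm_num)]; ring
    rw [h1]
    have : δ * E ≤ κ / 4 * E := by gcongr; linarith
    gcongr
  have hκ2 : 0 < κ ^ 2 := by positivity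
  have hbM : ∑ i ∈ M, b i ^ 2 ≤ Q ^ 2 := le_of_mul_le_mul_left (hmass.trans hδQ) hκ2
  have hMQ : M.card * L ^ 2 ≤ Q ^ 2 := by
    refine le_of_mul_le_mul_left (le_trans (le_of_eq ?_) (hcount.trans hδQ)) hκ2
    ring
  have hsupp' : supp β' ⊆ supp w := hls.1
  have hoff : ∑ i ∈ (supp w)ᶜ, e' i ^ 2 ≤ Q ^ 2 := by
    refine le_trans (le_of_eq ?_) hbM
    symm
    rw [← Finset.sum_subset (s₁ := M) (s₂ := (supp w)ᶜ)]
    · refine Finset.sum_congr rfl fun i hi => ?_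
      have h1 := eq_zero_of_supp_subset hsupp' (Finset.mem_sdiff.1 hi).2
      simp [he', h1]
    · intro i hi
      simpa using (Finset.mem_sdiff.1 hi).2
    · intro i hi hiM
      have hi' : i ∉ supp w := by simpa using hi
      have hiS : i ∉ S := fun h => hiM (Finset.mem_sdiff.2 ⟨h, hi'⟩)
      simp [he', eq_zero_of_supp_subset hsupp' hi', eq_zero_of_supp_subset hb hiS]
  -- False selections number at most `τ + M.card`; the `M.card` part costs at most `Q ^ 2` by `hMQ`.
  have hgsum : ∑ i ∈ supp w, g i ^ 2 ≤ (L * Real.sqrt τ + Q) ^ 2 := by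
    have h1 : ∑ i ∈ supp w, g i ^ 2 = ∑ i ∈ supp w \ S, g i ^ 2 := by
      symm
      apply Finset.sum_subset Finset.sdiff_subset
      intro i hi hi'
      have : i ∈ S := by
        by_contra hc
        exact hi' (Finset.mem_sdiff.2 ⟨hi, hc⟩)
      simp [hgS' i this]
    have h2 : ∑ i ∈ supp w \ S, g i ^ 2 ≤ (supp w \ S).card * L ^ 2 := by
      rw [← nsmul_eq_mul]
      refine Finset.sum_le_card_nsmul _ _ _ fun i hi => ?_
      have h3 : |g i| ≤ (1 - κ) * L := hgL i (Finset.mem_sdiff.1 hi).2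
      rw [← sq_abs]
      exact pow_le_pow_left₀ (abs_nonneg _)
        (h3.trans (mul_le_of_le_one_left hL (by linarith))) 2
    have h3 : (supp w \ S).card ≤ τ + M.card := by
      have h4 := Finset.card_le_card (Finset.sdiff_subset_sdiff hwT (le_refl S))
      have h5 := Finset.card_le_card (Finset.sdiff_subset_sdiff (le_refl S) hwT)
      rw [← hM] at h5
      have h6 := Finset.card_sdiff_add_card_inter S T
      have h7 := Finset.card_sdiff_add_card_inter T S
      rw [Finset.inter_comm] at h7
      omega
    have h4 : ((supp w \ S).card : ℝ) ≤ τ + M.card := by exact_mod_cast h3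
    have h5 : ((supp w \ S).card : ℝ) * L ^ 2 ≤ (τ + M.card) * L ^ 2 := by gcongr
    have h6 : (L * Real.sqrt τ) ^ 2 = τ * L ^ 2 := by
      rw [mul_pow, Real.sq_sqrt (Nat.cast_nonneg _)]; ring
    have h7 : 0 ≤ L * Real.sqrt τ * Q := by positivity
    rw [h1]
    nlinarith
  have hh'sum : ∑ i ∈ supp w, h' i ^ 2 ≤ (δ * E') ^ 2 := by
    apply hX.sum_residual_sq_le hn
    have h1 : supp e' ∪ supp w ⊆ T ∪ S := by
      refine Finset.union_subset ?_ (hwT.trans Finset.subset_union_left)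
      exact (supp_sub_subset β' b).trans (Finset.union_subset_union (hsupp'.trans hwT) hb)
    have h2 := Finset.card_le_card h1
    have h3 := Finset.card_union_le T S
    omega
  have hon : ∑ i ∈ supp w, e' i ^ 2 ≤ (δ * E' + (L * Real.sqrt τ + Q)) ^ 2 := by
    -- The gradient at `β'` vanishes on `supp w`, which makes the new error there equal to `h' + g`.
    have h1 : ∀ i ∈ supp w, e' i = h' i + g i := by
      intro i hi
      have h2 := hls.normal_eq hi
      have h3 : y - X *ᵥ β' = (y - X *ᵥ b) - X *ᵥ e' := by
        rw [he', Matrix.mulVec_sub]; abel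
      rw [h3, Matrix.mulVec_sub, Pi.sub_apply] at h2
      simp only [hh', hg, Pi.sub_apply, Pi.smul_apply, smul_eq_mul]
      linear_combination (n : ℝ)⁻¹ * -h2
    rw [Finset.sum_congr rfl fun i hi => by rw [h1 i hi]]
    exact sum_add_sq_le (by positivity) (by positivity) hh'sum hgsum
  have hfinal := l2_le_of_sum_sq_le (supp w) (by positivity) hQ0 hon hoff
  refine ⟨?_, (Finset.card_le_card (hsupp'.trans hwT)).trans hTle⟩
  -- The outcome is `0.995 E' ≤ 0.71 E + L √τ`, which leaves room for the factors `9 / 10` and `2`.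
  have hs2 : Real.sqrt 2 ≤ 1.42 := Real.sqrt_le_iff.2 ⟨by norm_num, by norm_num⟩
  have hQle : Q ≤ 0.355 * E := by
    have := mul_le_mul_of_nonneg_right hs2 hE0
    rw [hQ]; linarith
  have hδE : δ * E' ≤ 0.005 * E' := by gcongr
  have hLτ : 0 ≤ L * Real.sqrt τ := by positivity
  rw [← hE'] at hfinal
  linarith

/-! ### Sub-Gaussian tails of linear functionals. -/

section Tail

variable {Ω : Type*} [MeasurableSpace Ω] {μ : Measure Ω} {n : ℕ} {ξ : Fin n → Ω → ℝ} {σ : ℝ}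

/-- Sub-Gaussian tail of a linear functional of the noise. -/
lemma IsNoise.measureReal_dotProduct_ge_le (hξ : IsNoise μ ξ σ) {c : Fin n → ℝ} {V x : ℝ}
    (hV : 0 < V) (hc : σ ^ 2 * (c ⬝ᵥ c) ≤ V) (hx : 0 ≤ x) :
    μ.real {ω | x ≤ c ⬝ᵥ fun i => ξ i ω} ≤ Real.exp (-x ^ 2 / (2 * V)) := by
  have hindep : iIndepFun (fun i ω => c i * ξ i ω) μ :=
    hξ.indep.comp (fun i t => c i * t) fun i => measurable_const_mul (c i)
  obtain ⟨v, hv, hsum⟩ : ∃ v : NNReal, (v : ℝ) = σ ^ 2 * (c ⬝ᵥ c) ∧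
      HasSubgaussianMGF (fun ω => ∑ i, c i * ξ i ω) v μ := by
    refine ⟨_, ?_, HasSubgaussianMGF.sum_of_iIndepFun hindep (s := Finset.univ)
      fun i _ => (hξ.subgaussian i).const_mul (c i)⟩
    rw [NNReal.coe_sum, dotProduct, Finset.mul_sum]
    refine Finset.sum_congr rfl fun i _ => ?_
    change c i ^ 2 * ((σ ^ 2).toNNReal : ℝ) = σ ^ 2 * (c i * c i)
    rw [Real.coe_toNNReal _ (sq_nonneg σ)]
    ring
  have hvV : v ≤ V.toNNReal := by
    rw [← NNReal.coe_le_coe, Real.coe_toNNReal _ hV.le, hv]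
    exact hc
  have hV' : HasSubgaussianMGF (fun ω => ∑ i, c i * ξ i ω) V.toNNReal μ :=
    ⟨hsum.integrable_exp_mul, fun t => (hsum.mgf_le t).trans (by gcongr)⟩
  have := hV'.measure_ge_le hx
  rwa [Real.coe_toNNReal _ hV.le] at this

/-- Joint tail of two orthogonal linear functionals of the noise. -/
lemma IsNoise.measureReal_abs_add_abs_gt_le [IsProbabilityMeasure μ] (hξ : IsNoise μ ξ σ)
    {a c : Fin n → ℝ} {V x : ℝ} (hac : a ⬝ᵥ c = 0) (hV : 0 < V)
    (hc : σ ^ 2 * (a ⬝ᵥ a + c ⬝ᵥ c) ≤ V) (hx : 0 ≤ x) :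
    μ.real {ω | x < |a ⬝ᵥ fun i => ξ i ω| + |c ⬝ᵥ fun i => ξ i ω|} ≤
      4 * Real.exp (-x ^ 2 / (2 * V)) := by
  have hca : c ⬝ᵥ a = 0 := by rw [dotProduct_comm, hac]
  -- The sum of absolute values is one of the four functionals `±a ± c`, all of the same squared
  -- norm by orthogonality.
  have tail : ∀ d : Fin n → ℝ, d ⬝ᵥ d = a ⬝ᵥ a + c ⬝ᵥ c →
      μ.real {ω | x ≤ d ⬝ᵥ fun i => ξ i ω} ≤ Real.exp (-x ^ 2 / (2 * V)) := fun d hd =>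
    hξ.measureReal_dotProduct_ge_le hV (by rw [hd]; exact hc) hx
  have h1 := tail (a + c) (by simp [hac, hca])
  have h2 := tail (a - c) (by simp [hac, hca])
  have h3 := tail (-a + c) (by simp [hac, hca])
  have h4 := tail (-a - c) (by simp [hac, hca])
  have hsub : {ω | x < |a ⬝ᵥ fun i => ξ i ω| + |c ⬝ᵥ fun i => ξ i ω|} ⊆
      ({ω | x ≤ (a + c) ⬝ᵥ fun i => ξ i ω} ∪ {ω | x ≤ (a - c) ⬝ᵥ fun i => ξ i ω}) ∪
      ({ω | x ≤ (-a + c) ⬝ᵥ fun i => ξ i ω} ∪ {ω | x ≤ (-a - c) ⬝ᵥ fun i => ξ i ω}) := by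
    intro ω hω
    simp only [Set.mem_ofPred_eq, Set.mem_union, add_dotProduct, sub_dotProduct,
      neg_dotProduct] at hω ⊢
    rcases abs_choice (a ⬝ᵥ fun i => ξ i ω) with ha | ha <;>
      rcases abs_choice (c ⬝ᵥ fun i => ξ i ω) with hc | hc <;> rw [ha, hc] at hω
    · exact Or.inl (Or.inl hω.le)
    · exact Or.inl (Or.inr (by linarith))
    · exact Or.inr (Or.inl hω.le)
    · exact Or.inr (Or.inr (by linarith))
  refine (measureReal_mono hsub).trans ?_
  refine (measureReal_union_le _ _).trans ?_
  have h5 := measureReal_union_le (μ := μ) {ω | x ≤ (a + c) ⬝ᵥ fun i => ξ i ω}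
    {ω | x ≤ (a - c) ⬝ᵥ fun i => ξ i ω}
  have h6 := measureReal_union_le (μ := μ) {ω | x ≤ (-a + c) ⬝ᵥ fun i => ξ i ω}
    {ω | x ≤ (-a - c) ⬝ᵥ fun i => ξ i ω}
  linarith

end Tail

/-! ### Probability of the separation event. -/

/-- The numerical inequality behind the exponent `ε` of the failure probability. -/
lemma exponent_le {ε m : ℝ} (hε₀ : 0 < ε) (hm₀ : 0 < m) (hm₁ : m ≤ ε ^ 2)
    (hm₂ : m ≤ 0.005) :
    (2 + ε) * (2 - m) ≤ 4 * ((1 - 4 * m) * (1 + ε)) ^ 2 * (1 - m) := by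
  -- Multiplying the two bounds on `m` gives `m ^ 2 ≤ 0.005 ε ^ 2`, and `0.071 ^ 2 > 0.005`.
  have hmε : m ≤ 0.071 * ε := by
    apply le_of_sq_le_sq _ (by positivity)
    nlinarith
  have h1 : 1 - 9 * m ≤ (1 - 4 * m) ^ 2 * (1 - m) := by nlinarith [sq_nonneg m]
  have h2 : 1 + 2 * ε ≤ (1 + ε) ^ 2 := by nlinarith [sq_nonneg ε]
  have h3 : (1 - 9 * m) * (1 + 2 * ε) ≤ ((1 - 4 * m) ^ 2 * (1 - m)) * (1 + ε) ^ 2 :=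
    mul_le_mul h1 h2 (by positivity) (by nlinarith [sq_nonneg (1 - 4 * m)])
  nlinarith [mul_le_mul_of_nonneg_left hm₂ hε₀.le, mul_pos hε₀ hm₀]

/-- The oracle separates `S` from its complement with high probability. -/
lemma measureReal_not_separated_le {ε m δ σ : ℝ} {n p k : ℕ} {X : Matrix (Fin n) (Fin p) ℝ}
    {Ω : Type*} [MeasurableSpace Ω] {μ : Measure Ω} [IsProbabilityMeasure μ]
    {ξ : Fin n → Ω → ℝ} {βstar : Fin p → ℝ} {S : Finset (Fin p)}
    (hε₀ : 0 < ε) (hm₁ : m ≤ ε ^ 2) (hm₂ : m ≤ 0.005) (hδm : δ ≤ m)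
    (hn : 0 < n) (hσ : 0 < σ) (hcol : NormalizedColumns X) (hξ : IsNoise μ ξ σ)
    (hX : RIP X k δ) (hSk : S.card ≤ k) (hS : supp βstar ⊆ S) (hS₁ : 1 ≤ S.card) :
    μ.real {ω | ¬ ∀ i ∈ S, ∀ j ∉ S,
        |(n : ℝ)⁻¹ * (Xᵀ *ᵥ (response X βstar ξ ω -
            X *ᵥ olsOn X S (response X βstar ξ ω))) j| +
          |olsOn X S (response X βstar ξ ω) i - βstar i| ≤
        (1 - 4 * m) * ((2 + 2 * ε) * σ * Real.sqrt (2 * Real.log p / n))} ≤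
      ((S.card : ℝ) / p) ^ ε := by
  have hn' : (0 : ℝ) < n := by exact_mod_cast hn
  have hm₀ : 0 < m := hX.1.trans_le hδm
  have hSp : S.card ≤ p := by simpa using S.card_le_univ
  have hp : 1 ≤ p := hS₁.trans hSp
  have hp' : (1 : ℝ) ≤ p := by exact_mod_cast hp
  have hp0 : (0 : ℝ) < p := by linarith
  have hlog : 0 ≤ Real.log p := Real.log_nonneg hp'
  set x := (1 - 4 * m) * ((2 + 2 * ε) * σ * Real.sqrt (2 * Real.log p / n)) with hx
  have hx0 : 0 ≤ x := by
    have : 0 ≤ 1 - 4 * m := by linarith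
    positivity
  have h1m : 0 < 1 - m := by linarith
  -- Variance proxy `σ ^ 2 (1 / n + 1 / ((1 - m) n))`: score plus estimation error.
  set V := σ ^ 2 * ((2 - m) / ((1 - m) * n)) with hV
  have hV0 : 0 < V := by
    have : 0 < 2 - m := by linarith
    positivity
  have hexp : Real.exp (-x ^ 2 / (2 * V)) ≤ (p : ℝ) ^ (-(2 + ε)) := by
    rw [Real.rpow_def_of_pos hp0]
    apply Real.exp_le_exp.2
    rw [neg_div, mul_neg, neg_le_neg_iff, le_div_iff₀ (by positivity)]
    have hxx : x ^ 2 = (4 * ((1 - 4 * m) * (1 + ε)) ^ 2 * (1 - m)) *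
        (2 * σ ^ 2 * Real.log p / ((1 - m) * n)) := by
      rw [hx, mul_pow, mul_pow, Real.sq_sqrt (by positivity)]
      field_simp
      ring
    have hVV : Real.log p * (2 + ε) * (2 * V) =
        ((2 + ε) * (2 - m)) * (2 * σ ^ 2 * Real.log p / ((1 - m) * n)) := by
      rw [hV]; field_simp
    rw [hxx, hVV]
    exact mul_le_mul_of_nonneg_right (exponent_le hε₀ hm₀ hm₁ hm₂) (by positivity)
  have hG := hX.isUnit_det_gram hn hSk
  set bad : Fin p × Fin p → Set Ω := fun q => {ω | x <
        |(n : ℝ)⁻¹ * (Xᵀ *ᵥ (response X βstar ξ ω -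
            X *ᵥ olsOn X S (response X βstar ξ ω))) q.2| +
          |olsOn X S (response X βstar ξ ω) q.1 - βstar q.1|} with hbad
  have hpair : ∀ q ∈ S ×ˢ Sᶜ, μ.real (bad q) ≤ 4 * (p : ℝ) ^ (-(2 + ε)) := by
    rintro ⟨i, j⟩ hq
    rw [Finset.mem_product] at hq
    obtain ⟨u, hu, hui⟩ := hX.exists_olsOn_error hn hSk hS hq.1
    obtain ⟨a, ha, hau, haj⟩ := exists_olsOn_score hn hcol hG hS j
    have hset : bad (i, j) = {ω | x < |a ⬝ᵥ fun i => ξ i ω| +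
        |(cols X S *ᵥ u) ⬝ᵥ fun i => ξ i ω|} := by
      ext ω
      simp only [hbad, response, Set.mem_ofPred_eq]
      rw [haj, hui]
    rw [hset]
    refine (hξ.measureReal_abs_add_abs_gt_le (hau u) hV0 ?_ hx0).trans (by gcongr)
    rw [hV]
    gcongr
    have h1 : ((1 - δ) * n)⁻¹ ≤ ((1 - m) * n)⁻¹ := by gcongr
    calc a ⬝ᵥ a + (cols X S *ᵥ u) ⬝ᵥ (cols X S *ᵥ u) ≤ (n : ℝ)⁻¹ + ((1 - m) * n)⁻¹ := by
          linarith
      _ = (2 - m) / ((1 - m) * n) := by field_simp; ring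
  have hsub : {ω | ¬ ∀ i ∈ S, ∀ j ∉ S,
        |(n : ℝ)⁻¹ * (Xᵀ *ᵥ (response X βstar ξ ω -
            X *ᵥ olsOn X S (response X βstar ξ ω))) j| +
          |olsOn X S (response X βstar ξ ω) i - βstar i| ≤ x} ⊆ ⋃ q ∈ S ×ˢ Sᶜ, bad q := by
    intro ω hω
    simp only [Set.mem_ofPred_eq, not_forall, not_le] at hω
    obtain ⟨i, hi, j, hj, hij⟩ := hω
    simp only [Set.mem_iUnion]
    exact ⟨(i, j), by simp [hi, hj], hij⟩
  -- There are `S.card * (p - S.card) ≤ p ^ 2 / 4` pairs, which absorbs the factor 4 from the signs.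
  have hcount : 4 * (((S ×ˢ Sᶜ).card : ℕ) : ℝ) ≤ (p : ℝ) ^ (2 : ℝ) := by
    have h1 : (S.card : ℝ) + (Sᶜ.card : ℝ) = p := by
      exact_mod_cast (by simp : S.card + Sᶜ.card = p)
    rw [Finset.card_product, Real.rpow_two, ← h1]
    push_cast
    nlinarith [sq_nonneg ((S.card : ℝ) - (Sᶜ.card : ℝ))]
  calc _ ≤ μ.real (⋃ q ∈ S ×ˢ Sᶜ, bad q) := measureReal_mono hsub (measure_ne_top _ _)
    _ ≤ ∑ q ∈ S ×ˢ Sᶜ, μ.real (bad q) := measureReal_biUnion_finset_le _ _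
    _ ≤ (S ×ˢ Sᶜ).card • (4 * (p : ℝ) ^ (-(2 + ε))) := Finset.sum_le_card_nsmul _ _ _ hpair
    _ = (4 * ((S ×ˢ Sᶜ).card : ℝ)) * (p : ℝ) ^ (-(2 + ε)) := by rw [nsmul_eq_mul]; ring
    _ ≤ (p : ℝ) ^ (2 : ℝ) * (p : ℝ) ^ (-(2 + ε)) := by gcongr
    _ = (1 / p : ℝ) ^ ε := by
      rw [← Real.rpow_add hp0, one_div, Real.inv_rpow hp0.le, ← Real.rpow_neg hp0.le]
      congr 1; ring
    _ ≤ ((S.card : ℝ) / p) ^ ε := by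
      have : (1 : ℝ) ≤ S.card := by exact_mod_cast hS₁
      gcongr

/-! ### Iteration and the main theorem. -/

/-- On the separation event the iterates approach the oracle geometrically, up to the contribution
of the `τ` superfluous coordinates. -/
lemma l2_iterate_sub_le {n p τ : ℕ} {X : Matrix (Fin n) (Fin p) ℝ} {y : Fin n → ℝ}
    {S : Finset (Fin p)} {βstar : Fin p → ℝ} {β : ℕ → Fin p → ℝ} {κ L δ : ℝ}
    (hX : RIP X (3 * (S.card + τ)) δ) (hn : 0 < n) (hκ1 : κ ≤ 1) (hδκ : 4 * δ ≤ κ)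
    (hδ : δ ≤ 0.005) (hL : 0 ≤ L) (hSp : ∃ j, j ∉ S) (hβstar : ∀ i ∈ S, L ≤ |βstar i|)
    (hsep : ∀ i ∈ S, ∀ j ∉ S, |(n : ℝ)⁻¹ * (Xᵀ *ᵥ (y - X *ᵥ olsOn X S y)) j| +
      |olsOn X S y i - βstar i| ≤ (1 - κ) * L)
    (hinit : (supp (β 0)).card ≤ S.card + τ)
    (hstep : ∀ t, IsStep X y (S.card + τ) (β t) (β (t + 1))) (hS : S.Nonempty) (t : ℕ) :
    l2 (β t - olsOn X S y) ≤
      (9 / 10) ^ t * l2 (β 0 - olsOn X S y) + 20 * L * Real.sqrt τ := by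
  have hκ : 0 < κ := by linarith [hX.1]
  have hG := hX.isUnit_det_gram (S := S) hn (by omega)
  have hone : ∀ t, (supp (β t)).card ≤ S.card + τ →
      l2 (β (t + 1) - olsOn X S y) ≤
          9 / 10 * l2 (β t - olsOn X S y) + 2 * L * Real.sqrt τ ∧
        (supp (β (t + 1))).card ≤ S.card + τ := by
    intro t ht
    refine (hstep t).l2_sub_le hX hn hκ hκ1 hδκ hδ hL (supp_olsOn_subset X S y) hSp
      (fun i hi => olsOn_normal_eq hG y hi) (fun i hi j hj => ?_) (fun j hj => ?_) ht
    · have h1 := hsep i hi j hj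
      have h2 := hβstar i hi
      have h3 : |βstar i| - |olsOn X S y i| ≤ |olsOn X S y i - βstar i| := by
        rw [abs_sub_comm]
        exact abs_sub_abs_le_abs_sub _ _
      linarith
    · obtain ⟨i, hi⟩ := hS
      linarith [hsep i hi j hj, abs_nonneg (olsOn X S y i - βstar i)]
  have hcard : ∀ t, (supp (β t)).card ≤ S.card + τ := by
    intro t
    induction t with
    | zero => exact hinit
    | succ t ih => exact (hone t ih).2
  -- The constant 20 is the fixed point of `c ↦ 9 / 10 * c + 2`.
  induction t with
  | zero =>
    have : 0 ≤ L * Real.sqrt τ := by positivity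
    simp only [pow_zero, one_mul]
    linarith
  | succ t ih =>
    have h := (hone t (hcard t)).1
    rw [pow_succ]
    linarith

lemma l2_le_sqrt_card_mul {p : ℕ} {v : Fin p → ℝ} {S : Finset (Fin p)} {L : ℝ} (hL : 0 ≤ L)
    (hv : supp v ⊆ S) (h : ∀ i ∈ S, |v i| ≤ L) : l2 v ≤ Real.sqrt S.card * L := by
  apply le_of_sq_le_sq _ (by positivity)
  rw [← l2_sq_restrict hv, l2_sq, Finset.sum_coe_sort S (fun i => v i ^ 2), mul_pow,
    Real.sq_sqrt (Nat.cast_nonneg _), ← nsmul_eq_mul]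
  refine Finset.sum_le_card_nsmul _ _ _ fun i hi => ?_
  rw [← sq_abs]
  exact pow_le_pow_left₀ (abs_nonneg _) (h i hi) 2

end HTP

theorem theorem4 (ε : ℝ) (hε₀ : 0 < ε) (hε₁ : ε < 1) :
    ∃ C₂ > (0 : ℝ), ∃ C₃ > (0 : ℝ), ∀ Cinit > (0 : ℝ), ∃ C₁ > (0 : ℝ),
      ∀ (n p sstar τ smax : ℕ) (σ lam δ Csize : ℝ) (X : Matrix (Fin n) (Fin p) ℝ)
        (Ω : Type*) [MeasurableSpace Ω] (μ : Measure Ω) [IsProbabilityMeasure μ]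
        (ξ : Fin n → Ω → ℝ),
        0 < n → 1 ≤ sstar → τ ≤ 3 * sstar → 0 < σ →
        HTP.NormalizedColumns X →
        HTP.IsNoise μ ξ σ →
        HTP.RIP X (3 * (sstar + τ)) δ →
        δ < min (ε ^ 2) 0.005 →
        0 < Csize → sstar + τ ≤ smax → Csize * smax * Real.log (p / smax) ≤ n →
        (1 + 3 * ε) * σ * Real.sqrt (2 * Real.log (p / sstar) / n) ≤ lam →
        (2 + 2 * ε) * σ * Real.sqrt (2 * Real.log p / n) ≤ lam →
        ∀ βstar ∈ HTP.signalClass p sstar lam, ∀ β : ℕ → Ω → Fin p → ℝ,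
          (∀ᵐ ω ∂μ, HTP.l2 (β 0 ω - βstar) ≤
              Cinit * σ * Real.sqrt (sstar * Real.log (p / sstar) / n) ∧
            (HTP.supp (β 0 ω)).card ≤ sstar + τ) →
          (∀ ω t, HTP.IsStep X (HTP.response X βstar ξ ω) (sstar + τ) (β t ω) (β (t + 1) ω)) →
          (∀ t : ℕ,
            μ.real {ω |
                (9 / 10 : ℝ) ^ t * C₁ * σ * Real.sqrt (sstar * Real.log p / n) +
                    C₂ * σ * Real.sqrt (2 * τ * Real.log p / n) ≤
                  HTP.l2 (β t ω -
                    HTP.olsOn X (HTP.supp βstar) (HTP.response X βstar ξ ω))} ≤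
              ((sstar : ℝ) / p) ^ C₃) ∧
          (τ = 0 →
            μ.real {ω | ¬ Tendsto (fun t => β t ω) atTop
                (𝓝 (HTP.olsOn X (HTP.supp βstar) (HTP.response X βstar ξ ω)))} ≤
              ((sstar : ℝ) / p) ^ C₃) := by

  -- Since `2 + 2ε ≤ 4`, `80 = 20 * 4`. The oracle lies within `6 σ R` of `βstar`, with `6 = 4 *
  -- 1.5` and `√2 ≤ 1.5`; one more unit makes the final comparison strict.
  refine ⟨80, by norm_num, ε, hε₀, fun Cinit hC => ⟨Cinit + 7, by positivity, ?_⟩⟩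
  intro n p sstar τ smax σ lam δ Csize X Ω _ μ _ ξ hn hs _ hσ hcol hξ hX hδ _ _ _ _ hlam
    βstar hβstar β hinit hstep
  obtain ⟨hcard, hmin⟩ := hβstar
  set S := HTP.supp βstar with hS
  subst hcard
  have hSp : S.card ≤ p := by simpa using S.card_le_univ
  have hn' : (0 : ℝ) < n := by exact_mod_cast hn
  have hp0 : (0 : ℝ) < p := by exact_mod_cast hs.trans hSp
  -- With full support the claimed bound is 1; otherwise some `j ∉ S` exists, as the separation
  -- argument needs.
  rcases hSp.eq_or_lt with hfull | hlt
  · have h1 : ((S.card : ℝ) / p) ^ ε = 1 := by rw [hfull, div_self hp0.ne', Real.one_rpow]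
    rw [h1]
    exact ⟨fun _ => measureReal_le_one, fun _ => measureReal_le_one⟩
  have hs' : (1 : ℝ) ≤ S.card := by exact_mod_cast hs
  have hp1 : (1 : ℝ) < p := by exact_mod_cast hs.trans_lt hlt
  have hlog : 0 < Real.log p := Real.log_pos hp1
  set m := min (ε ^ 2) 0.005 with hm
  have hm₁ : m ≤ ε ^ 2 := min_le_left _ _
  have hm₂ : m ≤ 0.005 := min_le_right _ _
  set y := HTP.response X βstar ξ with hy
  set L := (2 + 2 * ε) * σ * Real.sqrt (2 * Real.log p / n) with hL
  have hL0 : 0 ≤ L := by positivity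
  have hprob := HTP.measureReal_not_separated_le hε₀ hm₁ hm₂ hδ.le hn hσ hcol hξ hX
    (by omega) (le_refl S) hs
  set R := Real.sqrt (S.card * Real.log p / n) with hR
  have hR0 : 0 < R := by positivity
  set bad : Set Ω := {ω | ¬ ∀ i ∈ S, ∀ j ∉ S,
        |(n : ℝ)⁻¹ * (Xᵀ *ᵥ (y ω - X *ᵥ HTP.olsOn X S (y ω))) j| +
          |HTP.olsOn X S (y ω) i - βstar i| ≤ (1 - 4 * m) * L} with hbad
  have hgood : ∀ᵐ ω ∂μ, ω ∉ bad → ∀ t, HTP.l2 (β t ω - HTP.olsOn X S (y ω)) ≤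
      (9 / 10) ^ t * ((Cinit + 6) * σ * R) + 20 * L * Real.sqrt τ := by
    filter_upwards [hinit] with ω h0 hω t
    have hsep := not_not.1 hω
    have hSp' : ∃ j, j ∉ S := by
      by_contra hall
      push Not at hall
      rw [Finset.eq_univ_of_forall hall] at hlt
      simp at hlt
    have hSne : S.Nonempty := Finset.card_pos.1 hs
    have ht := HTP.l2_iterate_sub_le (β := fun t => β t ω) hX hn (κ := 4 * m) (by linarith)
      (by linarith) (by linarith) hL0 hSp' (fun i hi => hlam.trans (hmin i hi)) hsep h0.2
      (hstep ω) hSne t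
    refine ht.trans ?_
    have hd : HTP.l2 (βstar - HTP.olsOn X S (y ω)) ≤ Real.sqrt S.card * L := by
      apply HTP.l2_le_sqrt_card_mul hL0
      · exact (HTP.supp_sub_subset _ _).trans
          (Finset.union_subset le_rfl (HTP.supp_olsOn_subset _ _ _))
      · intro i hi
        obtain ⟨j, hj⟩ := hSp'
        rw [Pi.sub_apply, abs_sub_comm]
        have h1 := hsep i hi j hj
        have h2 := abs_nonneg ((n : ℝ)⁻¹ * (Xᵀ *ᵥ (y ω - X *ᵥ HTP.olsOn X S (y ω))) j)
        have h3 : 0 ≤ m * L := mul_nonneg (by linarith [hX.1]) hL0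
        linarith
    have hLR : Real.sqrt S.card * L ≤ 6 * σ * R := by
      have h1 : Real.sqrt S.card * Real.sqrt (2 * Real.log p / n) = Real.sqrt 2 * R := by
        rw [hR, ← Real.sqrt_mul (by positivity), ← Real.sqrt_mul (by norm_num)]
        congr 1; ring
      have hs2 : Real.sqrt 2 ≤ 1.5 := Real.sqrt_le_iff.2 ⟨by norm_num, by norm_num⟩
      calc Real.sqrt S.card * L = (2 + 2 * ε) * σ *
            (Real.sqrt S.card * Real.sqrt (2 * Real.log p / n)) := by rw [hL]; ring
        _ = (2 + 2 * ε) * σ * (Real.sqrt 2 * R) := by rw [h1]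
        _ ≤ 4 * σ * (1.5 * R) := by gcongr; linarith
        _ = 6 * σ * R := by ring
    have hinitR : HTP.l2 (β 0 ω - βstar) ≤ Cinit * σ * R := by
      refine h0.1.trans ?_
      rw [hR]
      gcongr
      exact div_le_self hp0.le hs'
    have htri : HTP.l2 (β 0 ω - HTP.olsOn X S (y ω)) ≤ (Cinit + 6) * σ * R := by
      have h1 := HTP.l2_add_le (β 0 ω - βstar) (βstar - HTP.olsOn X S (y ω))
      rw [sub_add_sub_cancel] at h1
      linarith
    gcongr
  -- Every failure, for each `t` and for the limit, lies almost surely in the single event `bad`.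
  have hle : ∀ A : Set Ω, (∀ᵐ ω ∂μ, ω ∈ A → ω ∈ bad) → μ.real A ≤ ((S.card : ℝ) / p) ^ ε :=
    fun A hA => (ENNReal.toReal_mono (measure_ne_top _ _) (measure_mono_ae hA)).trans hprob
  refine ⟨fun t => hle _ ?_, fun hτ => hle _ ?_⟩
  · filter_upwards [hgood] with ω h hω
    by_contra hb
    have h1 := h hb t
    have h2 : (9 / 10 : ℝ) ^ t * (Cinit + 7) * σ * R + 80 * σ * Real.sqrt (2 * τ * Real.log p / n) ≤
      HTP.l2 (β t ω - HTP.olsOn X S (y ω)) := hω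
    have h3 : 20 * L * Real.sqrt τ ≤ 80 * σ * Real.sqrt (2 * τ * Real.log p / n) := by
      have h4 : Real.sqrt (2 * Real.log p / n) * Real.sqrt τ =
          Real.sqrt (2 * τ * Real.log p / n) := by
        rw [← Real.sqrt_mul (by positivity)]
        congr 1; ring
      calc 20 * L * Real.sqrt τ = 20 * ((2 + 2 * ε) * σ *
            (Real.sqrt (2 * Real.log p / n) * Real.sqrt τ)) := by rw [hL]; ring
        _ ≤ 20 * ((2 + 2 * 1) * σ * Real.sqrt (2 * τ * Real.log p / n)) := by rw [h4]; gcongr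
        _ = _ := by ring
    have h5 : 0 < (9 / 10 : ℝ) ^ t * (σ * R) := by positivity
    linarith
  · filter_upwards [hgood] with ω h hω
    by_contra hb
    refine hω (tendsto_iff_norm_sub_tendsto_zero.2 ?_)
    have h1 : Tendsto (fun t : ℕ => (9 / 10 : ℝ) ^ t * ((Cinit + 6) * σ * R)) atTop (𝓝 0) := by
      simpa using (tendsto_pow_atTop_nhds_zero_of_lt_one (by norm_num : (0 : ℝ) ≤ 9 / 10)
        (by norm_num)).mul_const ((Cinit + 6) * σ * R)
    refine squeeze_zero (fun _ => norm_nonneg _) (fun t => ?_) h1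
    have h2 := h hb t
    rw [hτ, Nat.cast_zero, Real.sqrt_zero, mul_zero, add_zero] at h2
    refine le_trans ?_ h2
    -- Convergence in `Fin p → ℝ` is in the sup norm, which `l2` dominates.
    exact (pi_norm_le_iff_of_nonneg (HTP.l2_nonneg _)).2 fun i => HTP.abs_le_l2 _ i
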